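/- Let $q$ be a prime power and $m,n\ge 1$. Fix a basis of $\mathbb{F}_{q^m}$ over $\mathbb{F}_q$. For $x\in\mathbb{F}_{q^m}^n$ let $\Gamma(x)\in\mathbb{F}_q^{n\times m}$ be the matrix whose $i$-th row is the coordinate vector of $x_i$ in this basis. The support $\sigma(x)\le\mathbb{F}_q^n$ of $x$ is the column space of $\Gamma(x)$, and the rank (weight) of $x$ is $\dim_{\mathbb{F}_q}\sigma(x)$; neither depends on the basis. An $\mathbb{F}_{q^m}$-$[n,k,d]$ code is a nonzero $k$-dimensional $\mathbb{F}_{q^m}$-subspace $C$ of $\mathbb{F}_{q^m}^n$ whose nonzero elements have minimum rank $d$, and $C^\perp$ is its dual with respect to the standard dot product. A codeword $c\in C$ is called minimal (in $C$) if every $c'\in C$ with $\sigma(c')\le\sigma(c)$ is an $\mathbb{F}_{q^m}$-multiple of $c$. For positive integers $t,w$, a set $\mathcal{B}$ of $w$-dimensional subspaces of $\mathbb{F}_q^n$ forms the blocks of a $t$-design over $\mathbb{F}_q$ if there is an integer $\lambda\ge 0$ such that every $t$-dimensional subspace of $\mathbb{F}_q^n$ is contained in exactly $\lambda$ members of $\mathcal{B}$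 (the case $\lambda=0$, in particular $\mathcal B=\emptyset$, is allowed). Let $C$ be an $\mathbb{F}_{q^m}$-$[n,k,d]$ code, let $1\le t<d$, and let $C^\perp$ be an $\mathbb{F}_{q^m}$-$[n,n-k,d^\perp]$ code with at most $d-t$ distinct rank weights in $\{1,\ldots,n-t\}$. Let $p$ (respectively $p^\perp$) be the greatest element of $\mathbb{N}\cup\{\infty\}$ such that every codeword of $C$ (respectively of $C^\perp$) of rank at most $p$ (respectively at most $p^\perp$) is minimal in $C$ (respectively in $C^\perp$). Then: 1. The supports of the codewords of rank $d$ in $C$ form the blocks of a $t$-design over $\mathbb{F}_q$, and so do the supports of the codewords of rank $d^\perp$ in $C^\perp$. 2. For each integer $i$ with $d\le i\le p$, the $\min\{i,n-t\}$-dimensional supports of minimal codewords of $C$ form the blocks of a $t$-design over $\mathbb{F}_q$. For each integer $i$ with $d^\perp\le i\le p^\perp$, the $\min\{i,n-t\}$-dimensional supports of minimal codewords of $C^\perp$ form the blocks of a $t$-design over $\mathbb{F}_q$. -/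

import Mathlib

namespace RankMetric

section Codes

variable {F K : Type*} [Field F] [Field K] [Algebra F K] {m n : ℕ}

/-- The `n × m` matrix over `F` whose `i`-th row is the coordinate vector of `x i` with respect to
the basis `Γ` of `K` over `F`. -/
noncomputable def expand (Γ : Module.Basis (Fin m) F K) (x : Fin n → K) :
    Matrix (Fin n) (Fin m) F :=
  Matrix.of fun i j => Γ.repr (x i) j

/-- The support of `x`: the column space of its expansion, a subspace of `F ^ n`. -/
noncomputable def support (Γ : Module.Basis (Fin m) F K) (x : Fin n → K) :
    Submodule F (Fin n → F) :=
  Submodule.span F (Set.range (expand Γ x).col)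

/-- The rank (weight) of `x`: the rank over `F` of its expansion. -/
noncomputable def rankWt (Γ : Module.Basis (Fin m) F K) (x : Fin n → K) : ℕ :=
  (expand Γ x).rank

/-- `C` is a `K`-linear `[n, k, d]` rank-metric code: it has `K`-dimension `k`, and `d` is the
minimum rank of a nonzero codeword (in particular a nonzero codeword exists). -/
def IsCode (Γ : Module.Basis (Fin m) F K) (C : Submodule K (Fin n → K)) (k d : ℕ) : Prop :=
  Module.finrank K C = k ∧ IsLeast {w : ℕ | ∃ c ∈ C, c ≠ 0 ∧ rankWt Γ c = w} d

/-- The dual code with respect to the standard dot product on `K ^ n`. -/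
def dualCode (C : Submodule K (Fin n → K)) : Submodule K (Fin n → K) where
  carrier := {y | ∀ x ∈ C, x ⬝ᵥ y = 0}
  zero_mem' := fun x _ => dotProduct_zero x
  add_mem' := fun {a b} ha hb x hx => by rw [dotProduct_add, ha x hx, hb x hx, add_zero]
  smul_mem' := fun c y hy x hx => by rw [dotProduct_smul, hy x hx, smul_zero]

/-- A codeword `c` of `C` is minimal if every codeword whose support is contained in that of `c`
is a `K`-multiple of `c`. -/
def IsMinimalWord (Γ : Module.Basis (Fin m) F K) (C : Submodule K (Fin n → K))
    (c : Fin n → K) : Prop :=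
  c ∈ C ∧ ∀ c' ∈ C, support Γ c' ≤ support Γ c → ∃ ν : K, c' = ν • c

/-- The greatest `p` such that every codeword of `C` of rank at most `p` is minimal
(`p = ⊤` if all codewords of `C` are minimal). -/
noncomputable def minimalBound (Γ : Module.Basis (Fin m) F K) (C : Submodule K (Fin n → K)) : ℕ∞ :=
  sSup {p : ℕ∞ | ∀ c ∈ C, (rankWt Γ c : ℕ∞) ≤ p → IsMinimalWord Γ C c}

/-- The supports of the codewords of `C` of rank weight `w`. -/
def supportsOfWeight (Γ : Module.Basis (Fin m) F K) (C : Submodule K (Fin n → K)) (w : ℕ) :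
    Set (Submodule F (Fin n → F)) :=
  {U | ∃ c ∈ C, rankWt Γ c = w ∧ support Γ c = U}

/-- The `w`-dimensional supports of the minimal codewords of `C`. -/
def minimalSupports (Γ : Module.Basis (Fin m) F K) (C : Submodule K (Fin n → K)) (w : ℕ) :
    Set (Submodule F (Fin n → F)) :=
  {U | Module.finrank F U = w ∧ ∃ c, IsMinimalWord Γ C c ∧ support Γ c = U}

end Codes

/-- `B` is the set of blocks of a `t`-design over `F` with blocks of dimension `k` in `E`: `t` and
`k` are positive, every member of `B` is a `k`-dimensional subspace of `E`, and all `t`-dimensional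
subspaces of `E` are contained in the same number `l` of members of `B`. -/
def IsSubspaceDesign {F E : Type*} [Field F] [AddCommGroup E] [Module F E] (t k : ℕ)
    (B : Set (Submodule F E)) : Prop :=
  0 < t ∧ 0 < k ∧ (∀ U ∈ B, Module.finrank F U = k) ∧
    ∃ l : ℕ, ∀ T : Submodule F E, Module.finrank F T = t → {U ∈ B | T ≤ U}.encard = l

end RankMetric

namespace RankMetric

open Module

/-! ### Orthogonal complements for the dot product. -/

section Dual

variable {K : Type*} [Field K] {n : ℕ}

/-! This is an Assmus–Mattson argument for the rank metric. For a subspace `X` of `F ^ n`, the words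
supported in `X` form a `K`-space of dimension `dim X`, and these spaces are compatible with
orthogonal complements. Hence `finrank_inf_extension_dualCode`, a basic form of the MacWilliams
identities, relates the words of `C` supported in `Xᗮ` to the words of `Cᗮ` supported in `X`.

The counting tool is a moment method. For subspaces `S i` and a fixed `Y`, the sum of `|S i ∩ Y| ^
j` counts pairs of an index and a `j`-tuple in `Y` whose span lies in `S i`. If the dimensions of `S
i ∩ Y` take at most `r` values, the moments `j < r` determine their distribution
(`card_finrank_inf_eq`).

Let `dim T = t`. As `C` has minimum rank `d`, the moments of order `j < d - t` of the dual words
supported in `Tᗮ` depend on `T` only through `t`; with at most `d - t` weights, so does their weight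
distribution. Taking complements gives the design property for `Cᗮ` in ranks at most `n - t`. By
duality the distribution of `dim (σ(c) + T)` over `c ∈ C` is independent of `T` as well, and
induction on the rank isolates the words with `T ≤ σ(c)`, which gives the design property for `C`.

These counts are of words. If all words of the rank considered are minimal, each support carries
exactly `|K| - 1` of them, so the supports themselves form a design. The leftover case `d' + t > n`
forces `Cᗮ` to attain the Singleton bound, and every `d'`-dimensional subspace is then a support. -/

theorem mem_dualCode {C : Submodule K (Fin n → K)} {y : Fin n → K} :
    y ∈ dualCode C ↔ ∀ x ∈ C, x ⬝ᵥ y = 0 := Iff.rfl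

theorem dualCode_eq_comap (C : Submodule K (Fin n → K)) :
    dualCode C = C.dualAnnihilator.comap (dotProductEquiv K (Fin n)).toLinearMap := by
  ext y
  simp only [mem_dualCode, Submodule.mem_comap, Submodule.mem_dualAnnihilator]
  refine forall₂_congr fun x _ => ?_
  rw [dotProduct_comm]
  rfl

theorem finrank_add_finrank_dualCode (C : Submodule K (Fin n → K)) :
    finrank K C + finrank K (dualCode C) = n := by
  have h := Subspace.finrank_add_finrank_dualAnnihilator_eq C
  rw [finrank_fin_fun] at h
  rw [dualCode_eq_comap, Submodule.comap_equiv_eq_map_symm, LinearEquiv.finrank_map_eq, h]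

theorem dualCode_anti {C D : Submodule K (Fin n → K)} (h : C ≤ D) : dualCode D ≤ dualCode C :=
  fun _ hy x hx => hy x (h hx)

theorem dualCode_dualCode (C : Submodule K (Fin n → K)) : dualCode (dualCode C) = C := by
  have h1 := finrank_add_finrank_dualCode C
  have h2 := finrank_add_finrank_dualCode (dualCode C)
  refine (Submodule.eq_of_le_of_finrank_le ?_ (by omega)).symm
  intro x hx y hy
  rw [dotProduct_comm]
  exact hy x hx

theorem le_dualCode_comm {C D : Submodule K (Fin n → K)} : C ≤ dualCode D ↔ D ≤ dualCode C := by
  constructor <;> intro h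
  · simpa only [dualCode_dualCode] using dualCode_anti h
  · simpa only [dualCode_dualCode] using dualCode_anti h

theorem dualCode_le_dualCode {C D : Submodule K (Fin n → K)} :
    dualCode D ≤ dualCode C ↔ C ≤ D := by
  rw [le_dualCode_comm, dualCode_dualCode]

theorem dualCode_sup (C D : Submodule K (Fin n → K)) :
    dualCode (C ⊔ D) = dualCode C ⊓ dualCode D := by
  apply le_antisymm
  · exact le_inf (dualCode_anti le_sup_left) (dualCode_anti le_sup_right)
  · rw [le_dualCode_comm]
    exact sup_le (le_dualCode_comm.1 inf_le_left) (le_dualCode_comm.1 inf_le_right)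

end Dual

/-! ### Supports, extension of scalars and the duality identity. -/

section Support

variable {F K : Type*} [Field F] [Field K] [Algebra F K] {m n : ℕ}
  (Γ : Module.Basis (Fin m) F K)

theorem rankWt_eq_finrank (c : Fin n → K) : rankWt Γ c = finrank F (support Γ c) :=
  Matrix.rank_eq_finrank_span_cols _

theorem support_le_iff {c : Fin n → K} {X : Submodule F (Fin n → F)} :
    support Γ c ≤ X ↔ ∀ j, (expand Γ c).col j ∈ X := by
  rw [support, Submodule.span_le, Set.range_subset_iff]
  rfl

theorem rankWt_le (c : Fin n → K) : rankWt Γ c ≤ n := by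
  rw [rankWt_eq_finrank]
  simpa using (support Γ c).finrank_le

theorem expand_eq_zero_iff {c : Fin n → K} : expand Γ c = 0 ↔ c = 0 := by
  constructor
  · intro h
    ext i
    apply Γ.repr.injective
    ext j
    simpa [expand] using congrFun (congrFun h i) j
  · rintro rfl
    ext
    simp [expand]

theorem support_eq_bot_iff {c : Fin n → K} : support Γ c = ⊥ ↔ c = 0 := by
  rw [← expand_eq_zero_iff Γ, ← le_bot_iff, support_le_iff]
  constructor
  · intro h
    ext i j
    exact congrFun ((Submodule.mem_bot F).1 (h j)) i
  · intro h j
    rw [h]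
    exact Submodule.zero_mem _

theorem support_zero : support Γ (0 : Fin n → K) = ⊥ := (support_eq_bot_iff Γ).2 rfl

theorem rankWt_eq_zero_iff {c : Fin n → K} : rankWt Γ c = 0 ↔ c = 0 := by
  rw [rankWt_eq_finrank, Submodule.finrank_eq_zero, support_eq_bot_iff]

theorem rankWt_zero : rankWt Γ (0 : Fin n → K) = 0 := (rankWt_eq_zero_iff Γ).2 rfl

theorem sum_col_smul (c : Fin n → K) (i : Fin n) :
    c i = ∑ j, (expand Γ c).col j i • Γ j := (Γ.sum_repr (c i)).symm

theorem sum_smul_eq (c : Fin n → K) (w : Fin n → F) :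
    ∑ i, w i • c i = ∑ j, (w ⬝ᵥ (expand Γ c).col j) • Γ j := by
  conv_lhs => enter [2, i]; rw [sum_col_smul Γ c i]
  simp only [Finset.smul_sum, dotProduct, Finset.sum_smul, smul_smul]
  exact Finset.sum_comm

/-- Linear independence of `Γ` turns containment of the columns into equations with coefficients in
`F` on the entries of `c`. These are `K`-linear in `c`, which makes `extension` a `K`-subspace. -/
theorem support_le_dualCode_iff {c : Fin n → K} {X : Submodule F (Fin n → F)} :
    support Γ c ≤ dualCode X ↔ ∀ w ∈ X, ∑ i, w i • c i = 0 := by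
  rw [support_le_iff]
  constructor
  · intro h w hw
    rw [sum_smul_eq Γ]
    exact Finset.sum_eq_zero fun j _ => by rw [h j w hw, zero_smul]
  · intro h j w hw
    have := h w hw
    rw [sum_smul_eq Γ] at this
    exact Fintype.linearIndependent_iff.1 Γ.linearIndependent _ this j

/-- The extension of scalars of a subspace `X` of `F ^ n`: the words with support in `X`. -/
def extension (X : Submodule F (Fin n → F)) : Submodule K (Fin n → K) where
  carrier := {c | support Γ c ≤ X}
  zero_mem' := by
    change support Γ 0 ≤ X
    rw [support_zero]
    exact bot_le
  add_mem' := fun {a b} ha hb => by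
    change support Γ (a + b) ≤ X
    change support Γ a ≤ X at ha
    change support Γ b ≤ X at hb
    rw [← dualCode_dualCode X, support_le_dualCode_iff] at ha hb ⊢
    intro w hw
    simp [smul_add, Finset.sum_add_distrib, ha w hw, hb w hw]
  smul_mem' := fun ν a ha => by
    change support Γ (ν • a) ≤ X
    change support Γ a ≤ X at ha
    rw [← dualCode_dualCode X, support_le_dualCode_iff] at ha ⊢
    intro w hw
    have := congrArg (ν • ·) (ha w hw)
    simp only [Finset.smul_sum, smul_zero] at this
    rw [← this]
    exact Finset.sum_congr rfl fun i _ => smul_comm (w i) ν (a i)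

theorem mem_extension {X : Submodule F (Fin n → F)} {c : Fin n → K} :
    c ∈ extension Γ X ↔ support Γ c ≤ X := Iff.rfl

theorem support_smul_le (ν : K) (c : Fin n → K) : support Γ (ν • c) ≤ support Γ c :=
  (extension Γ (support Γ c)).smul_mem ν ((mem_extension Γ).2 le_rfl)

theorem support_smul {ν : K} (hν : ν ≠ 0) (c : Fin n → K) :
    support Γ (ν • c) = support Γ c := by
  apply le_antisymm (support_smul_le Γ ν c)
  conv_lhs => rw [← inv_smul_smul₀ hν c]
  exact support_smul_le Γ _ _

/-- A word with support in `X` amounts to the tuple of its columns, which are arbitrary in `X`. -/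
noncomputable def extensionEquiv (X : Submodule F (Fin n → F)) :
    extension Γ X ≃ (Fin m → X) where
  toFun c j := ⟨(expand Γ c.1).col j, (support_le_iff Γ).1 c.2 j⟩
  invFun y := ⟨fun i => ∑ j, (y j).1 i • Γ j, by
    rw [mem_extension, support_le_iff]
    intro j
    convert (y j).2 using 1
    ext i
    simp only [expand, Matrix.col_apply, Matrix.of_apply, Γ.repr_sum_self]⟩
  left_inv c := by
    ext i
    exact (sum_col_smul Γ c.1 i).symm
  right_inv y := by
    ext j i
    simp only [expand, Matrix.col_apply, Matrix.of_apply, Γ.repr_sum_self]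

/-- The columns are `m` free vectors of `X`, so the space has `|X| ^ m` elements; comparing with
powers of `|K| = |F| ^ m` gives the dimension. -/
theorem finrank_extension [Finite F] (X : Submodule F (Fin n → F)) :
    finrank K (extension Γ X) = finrank F X := by
  have := Module.Finite.of_basis Γ
  have : Finite K := Module.finite_of_finite F
  have h := Nat.card_congr (extensionEquiv Γ X)
  rw [Module.natCard_eq_pow_finrank (K := K), Nat.card_fun,
    Module.natCard_eq_pow_finrank (K := F) (V := X),
    Module.natCard_eq_pow_finrank (K := F) (V := K), finrank_eq_card_basis Γ,
    ← pow_mul, ← pow_mul] at h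
  have h2 := Nat.pow_right_injective (Finite.one_lt_card (α := F)) h
  have hm : 0 < m := by
    rcases Nat.eq_zero_or_pos m with rfl | h
    · exact absurd (Γ.repr.injective (Subsingleton.elim _ _)) (zero_ne_one' K)
    · exact h
  simp only [Fintype.card_fin, Nat.card_fin] at h2
  rw [mul_comm (finrank F X)] at h2
  exact Nat.eq_of_mul_eq_mul_left hm h2

theorem dualCode_extension [Finite F] (X : Submodule F (Fin n → F)) :
    dualCode (extension Γ X) = extension Γ (dualCode X) := by
  have h1 := finrank_add_finrank_dualCode X
  have h2 := finrank_add_finrank_dualCode (extension Γ X)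
  rw [finrank_extension] at h2
  refine (Submodule.eq_of_le_of_finrank_le ?_ (by rw [finrank_extension]; omega)).symm
  intro y hy x hx
  rw [mem_extension, support_le_dualCode_iff] at hy
  rw [mem_extension, support_le_iff] at hx
  have : ∀ i, x i * y i = ∑ j, Γ j * ((expand Γ x).col j i • y i) := fun i => by
    conv_lhs => rw [sum_col_smul Γ x i, Finset.sum_mul]
    exact Finset.sum_congr rfl fun j _ => by
      rw [smul_mul_assoc, mul_smul_comm]
  simp only [dotProduct, this]
  rw [Finset.sum_comm]
  refine Finset.sum_eq_zero fun j _ => ?_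
  rw [← Finset.mul_sum, hy _ (hx j), mul_zero]

/-- The space on the left is the dual of `dualCode C ⊔ extension Γ X`; the rest is the dimension
formula for sum and intersection. -/
theorem finrank_inf_extension_dualCode [Finite F] (C : Submodule K (Fin n → K))
    (X : Submodule F (Fin n → F)) :
    finrank K ↥(C ⊓ extension Γ (dualCode X)) + finrank F X =
      finrank K C + finrank K ↥(dualCode C ⊓ extension Γ X) := by
  have h1 := finrank_add_finrank_dualCode (dualCode C ⊔ extension Γ X)
  rw [dualCode_sup, dualCode_dualCode, dualCode_extension] at h1
  have h2 := Submodule.finrank_sup_add_finrank_inf_eq (dualCode C) (extension Γ X)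
  rw [finrank_extension] at h2
  have h3 := finrank_add_finrank_dualCode C
  omega

end Support

end RankMetric

namespace RankMetric

open Module

/-! ### Value distributions from power sums. -/

section Counting

/-- The number of indices at which a family of rationals with values in `W` takes the value `w`,
through its power sums of exponents less than `#W`. -/
theorem card_fiber_eq_sum_coeff_mul {ι : Type*} {s : Finset ι} {f : ι → ℚ} (W : Finset ℚ)
    (hf : ∀ i ∈ s, f i ∈ W) {w : ℚ} (hw : w ∈ W) :
    ((s.filter fun i => f i = w).card : ℚ) =
      ∑ j ∈ Finset.range W.card, (Lagrange.basis W id w).coeff j * ∑ i ∈ s, f i ^ j := by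
  have hdeg : (Lagrange.basis W id w).natDegree < W.card := by
    rw [Lagrange.natDegree_basis (Function.injective_id.injOn) hw]
    exact Nat.sub_lt (Finset.card_pos.2 ⟨w, hw⟩) one_pos
  have : ∀ i ∈ s, (if f i = w then (1 : ℚ) else 0) = (Lagrange.basis W id w).eval (f i) := by
    intro i hi
    split_ifs with h
    · rw [h]
      exact (Lagrange.eval_basis_self (v := id) Function.injective_id.injOn hw).symm
    · exact (Lagrange.eval_basis_of_ne (v := id) (Ne.symm h) (hf i hi)).symm
  rw [Finset.card_filter]
  push_cast
  rw [Finset.sum_congr rfl this]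
  simp_rw [Polynomial.eval_eq_sum_range' hdeg]
  rw [Finset.sum_comm]
  simp_rw [Finset.mul_sum]

/-- Two finite families of rationals with values among `r` nodes and with the same first `r` power
sums take every value equally often. -/
theorem card_fiber_eq_of_sum_pow_eq {ι ι' : Type*} {s : Finset ι} {s' : Finset ι'}
    {f : ι → ℚ} {f' : ι' → ℚ} (W : Finset ℚ) (hf : ∀ i ∈ s, f i ∈ W) (hf' : ∀ i ∈ s', f' i ∈ W)
    (h : ∀ j < W.card, ∑ i ∈ s, f i ^ j = ∑ i ∈ s', f' i ^ j) (w : ℚ) :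
    (s.filter fun i => f i = w).card = (s'.filter fun i => f' i = w).card := by
  by_cases hw : w ∈ W
  · have : ((s.filter fun i => f i = w).card : ℚ) = (s'.filter fun i => f' i = w).card := by
      rw [card_fiber_eq_sum_coeff_mul W hf hw, card_fiber_eq_sum_coeff_mul W hf' hw]
      exact Finset.sum_congr rfl fun j hj => by rw [h j (Finset.mem_range.1 hj)]
    exact_mod_cast this
  · rw [Finset.filter_false_of_mem fun i hi (hiw : f i = w) => hw (hiw ▸ hf i hi),
      Finset.filter_false_of_mem fun i hi (hiw : f' i = w) => hw (hiw ▸ hf' i hi)]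
    rfl

/-- Sums over two finite sets agree if corresponding fibers have the same size and the summands
depend only on the fiber. -/
theorem sum_eq_sum_of_card_fiber_eq {ι ι' κ M : Type*} [DecidableEq κ] [AddCommMonoid M]
    {s : Finset ι} {s' : Finset ι'} {g : ι → κ} {g' : ι' → κ} {f : ι → M} {f' : ι' → M}
    (hcard : ∀ w, (s.filter fun i => g i = w).card = (s'.filter fun i => g' i = w).card)
    (hf : ∀ i ∈ s, ∀ i' ∈ s', g i = g' i' → f i = f' i') :
    ∑ i ∈ s, f i = ∑ i ∈ s', f' i := by
  classical
  rw [← Finset.sum_fiberwise_of_maps_to (t := s.image g ∪ s'.image g') (g := g)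
      (fun i hi => Finset.mem_union_left _ (Finset.mem_image_of_mem g hi)),
    ← Finset.sum_fiberwise_of_maps_to (t := s.image g ∪ s'.image g') (g := g')
      (fun i hi => Finset.mem_union_right _ (Finset.mem_image_of_mem g' hi))]
  refine Finset.sum_congr rfl fun w _ => ?_
  refine Finset.sum_bij (fun i hi => (Finset.equivOfCardEq (hcard w) ⟨i, hi⟩).1)
    (fun i hi => (Finset.equivOfCardEq (hcard w) ⟨i, hi⟩).2) ?_ ?_ ?_
  · intro a ha b hb hab
    simpa using (Finset.equivOfCardEq (hcard w)).injective (Subtype.ext hab)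
  · intro b hb
    exact ⟨((Finset.equivOfCardEq (hcard w)).symm ⟨b, hb⟩).1,
      ((Finset.equivOfCardEq (hcard w)).symm ⟨b, hb⟩).2, by simp⟩
  · intro a ha
    have h1 := (Finset.mem_filter.1 ha)
    have h2 := (Finset.mem_filter.1 (Finset.equivOfCardEq (hcard w) ⟨a, ha⟩).2)
    exact hf _ h1.1 _ h2.1 (h1.2.trans h2.2.symm)

end Counting

/-! ### Moments and intersection numbers of families of subspaces. -/

section Subspaces

theorem exists_linearEquiv_extending {F V V' : Type*} [Field F] [AddCommGroup V] [Module F V]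
    [AddCommGroup V'] [Module F V'] [FiniteDimensional F V] [FiniteDimensional F V']
    (hV : finrank F V = finrank F V') {S : Submodule F V} {S' : Submodule F V'} (e : S ≃ₗ[F] S') :
    ∃ E : V ≃ₗ[F] V', ∀ x : S, E x = e x := by
  obtain ⟨Q, hQ⟩ := S.exists_isCompl
  obtain ⟨Q', hQ'⟩ := S'.exists_isCompl
  have h1 := Submodule.finrank_add_eq_of_isCompl hQ
  have h2 := Submodule.finrank_add_eq_of_isCompl hQ'
  have h3 := e.finrank_eq
  have f : Q ≃ₗ[F] Q' := LinearEquiv.ofFinrankEq _ _ (by omega)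
  refine ⟨(Submodule.prodEquivOfIsCompl S Q hQ).symm ≪≫ₗ (e.prodCongr f) ≪≫ₗ
    Submodule.prodEquivOfIsCompl S' Q' hQ', fun x => ?_⟩
  simp

variable {F V : Type*} [Field F] [AddCommGroup V] [Module F V]

/-- The general linear group is transitive on flags `S ≤ Y` of given dimensions. Independence of the
choice of a subspace is always obtained by transport along such an `E`. -/
theorem exists_linearEquiv_map_eq [FiniteDimensional F V] {S S' Y Y' : Submodule F V}
    (hSY : S ≤ Y) (hSY' : S' ≤ Y') (hS : finrank F S = finrank F S')
    (hY : finrank F Y = finrank F Y') :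
    ∃ E : V ≃ₗ[F] V, S.map E.toLinearMap = S' ∧ Y.map E.toLinearMap = Y' := by
  have e : S ≃ₗ[F] S' := LinearEquiv.ofFinrankEq _ _ hS
  obtain ⟨E₁, hE₁⟩ := exists_linearEquiv_extending hY
    ((Submodule.comapSubtypeEquivOfLe hSY) ≪≫ₗ e ≪≫ₗ
      (Submodule.comapSubtypeEquivOfLe hSY').symm)
  obtain ⟨E, hE⟩ := exists_linearEquiv_extending rfl E₁
  have hle : S.map E.toLinearMap ≤ S' := by
    rintro _ ⟨x, hx, rfl⟩
    have h1 := hE ⟨x, hSY hx⟩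
    have h2 := hE₁ ⟨⟨x, hSY hx⟩, hx⟩
    have : E x ∈ S' := by
      rw [show E x = _ from h1, h2]
      exact Submodule.coe_mem _
    exact this
  have hle' : Y.map E.toLinearMap ≤ Y' := by
    rintro _ ⟨x, hx, rfl⟩
    have : E x ∈ Y' := by
      rw [show E x = _ from hE ⟨x, hx⟩]
      exact Submodule.coe_mem _
    exact this
  exact ⟨E, Submodule.eq_of_le_of_finrank_eq hle (by rw [LinearEquiv.finrank_map_eq, hS]),
    Submodule.eq_of_le_of_finrank_eq hle' (by rw [LinearEquiv.finrank_map_eq, hY])⟩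

theorem span_range_map_submoduleMap {j : ℕ} {Y Y' : Submodule F V} (E : V ≃ₗ[F] V)
    (y : Fin j → Y) (y' : Fin j → Y') (h : ∀ l, E (y l) = y' l) :
    (Submodule.span F (Set.range fun l => (y l : V))).map E.toLinearMap =
      Submodule.span F (Set.range fun l => (y' l : V)) := by
  rw [Submodule.map_span, ← Set.range_comp]
  congr 2
  ext l
  exact h l

variable [Fintype V]

open scoped Classical in
-- `E` acts bijectively on tuples, and `j` vectors span at most `j` dimensions, so only subspaces of
-- that size need comparing.
theorem sum_tuples_eq {M : Type*} [AddCommMonoid M] {Y Y' : Submodule F V} (E : V ≃ₗ[F] V)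
    (hE : Y.map E.toLinearMap = Y') (j : ℕ) {φ φ' : Submodule F V → M}
    (h : ∀ X ≤ Y, finrank F X ≤ j → φ X = φ' (X.map E.toLinearMap)) :
    ∑ y : Fin j → Y, φ (Submodule.span F (Set.range fun l => (y l : V))) =
      ∑ y : Fin j → Y', φ' (Submodule.span F (Set.range fun l => (y l : V))) := by
  subst hE
  refine Fintype.sum_equiv (Equiv.arrowCongr (Equiv.refl _) (E.submoduleMap Y).toEquiv) _ _ ?_
  intro y
  rw [h, span_range_map_submoduleMap E y]
  · intro l
    rfl
  · rw [Submodule.span_le]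
    rintro _ ⟨l, rfl⟩
    exact (y l).2
  · exact (finrank_range_le_card _).trans (by simp)

open scoped Classical in
-- Double counting: the `j`-th power is the number of `j`-tuples in `S i ⊓ Y`.
theorem sum_card_inf_pow {ι : Type*} (s : Finset ι) (S : ι → Submodule F V) (Y : Submodule F V)
    (j : ℕ) :
    ∑ i ∈ s, (Nat.card ↥(S i ⊓ Y)) ^ j =
      ∑ y : Fin j → Y, (s.filter fun i => Submodule.span F (Set.range fun l => (y l : V)) ≤ S i).card
    := by
  have h := Finset.sum_card_bipartiteAbove_eq_sum_card_bipartiteBelow (s := s)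
    (t := (Finset.univ : Finset (Fin j → Y)))
    (fun i y => Submodule.span F (Set.range fun l => (y l : V)) ≤ S i)
  simp only [Finset.bipartiteAbove, Finset.bipartiteBelow] at h
  rw [← h]
  refine Finset.sum_congr rfl fun i _ => ?_
  have e : (Fin j → ↥(S i ⊓ Y)) ≃
      {y : Fin j → Y // Submodule.span F (Set.range fun l => (y l : V)) ≤ S i} :=
    { toFun := fun y => ⟨fun l => ⟨y l, (y l).2.2⟩, by
        rw [Submodule.span_le]
        rintro _ ⟨l, rfl⟩
        exact (y l).2.1⟩
      invFun := fun y l => ⟨y.1 l, y.2 (Submodule.subset_span ⟨l, rfl⟩), (y.1 l).2⟩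
      left_inv := fun y => rfl
      right_inv := fun y => rfl }
  have := Nat.card_congr e
  rw [Nat.card_fun, Nat.card_fin] at this
  rw [this, Nat.card_eq_fintype_card, Fintype.card_subtype]

variable [Finite F]

open scoped Classical in
/-- If the intersections of two families of subspaces with `Y` and `Y'` have their dimensions in
`W`, then the first `#W` moments determine how often each dimension occurs. -/
theorem card_finrank_inf_eq {ι ι' : Type*} {s : Finset ι} {s' : Finset ι'}
    {S : ι → Submodule F V} {S' : ι' → Submodule F V} {Y Y' : Submodule F V} (W : Finset ℕ)
    (hW : ∀ i ∈ s, finrank F ↥(S i ⊓ Y) ∈ W) (hW' : ∀ i ∈ s', finrank F ↥(S' i ⊓ Y') ∈ W)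
    (h : ∀ j < W.card,
      ∑ y : Fin j → Y, (s.filter fun i =>
        Submodule.span F (Set.range fun l => (y l : V)) ≤ S i).card =
      ∑ y : Fin j → Y', (s'.filter fun i =>
        Submodule.span F (Set.range fun l => (y l : V)) ≤ S' i).card) (r : ℕ) :
    (s.filter fun i => finrank F ↥(S i ⊓ Y) = r).card =
      (s'.filter fun i => finrank F ↥(S' i ⊓ Y') = r).card := by
  -- Cardinalities `|F| ^ r` determine `r`, so dimensions can be read off from power sums of
  -- cardinalities.
  have hinj : Function.Injective fun r : ℕ => ((Nat.card F : ℚ) ^ r) := by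
    intro a b hab
    have : Nat.card F ^ a = Nat.card F ^ b := by
      dsimp only at hab
      exact_mod_cast hab
    exact Nat.pow_right_injective (Finite.one_lt_card (α := F)) this
  have key := card_fiber_eq_of_sum_pow_eq (s := s) (s' := s')
    (f := fun i => (Nat.card F : ℚ) ^ finrank F ↥(S i ⊓ Y))
    (f' := fun i => (Nat.card F : ℚ) ^ finrank F ↥(S' i ⊓ Y'))
    (W.image fun r => (Nat.card F : ℚ) ^ r)
    (fun i hi => Finset.mem_image_of_mem _ (hW i hi))
    (fun i hi => Finset.mem_image_of_mem _ (hW' i hi)) (by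
      intro j hj
      have h1 := h j (hj.trans_le Finset.card_image_le)
      rw [← sum_card_inf_pow, ← sum_card_inf_pow] at h1
      have hc : ∀ X : Submodule F V, Nat.card X = Nat.card F ^ finrank F X := fun X =>
        Module.natCard_eq_pow_finrank
      simp only [hc] at h1
      exact_mod_cast h1) ((Nat.card F : ℚ) ^ r)
  simpa only [hinj.eq_iff] using key

open scoped Classical in
/-- A family of subspaces of dimension at least `t`, all of the same dimension, which covers all
`t`-dimensional subspaces equally often covers all `j`-dimensional subspaces equally often,
`j ≤ t`. -/
theorem card_le_eq_of_finrank_le {ι : Type*} {s : Finset ι} {S : ι → Submodule F V} {b t : ℕ}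
    (hb : ∀ i ∈ s, finrank F (S i) = b) (htb : t ≤ b)
    (h : ∀ T T' : Submodule F V, finrank F T = t → finrank F T' = t →
      (s.filter fun i => T ≤ S i).card = (s.filter fun i => T' ≤ S i).card)
    {X X' : Submodule F V} (hX : finrank F X ≤ t) (hXX' : finrank F X = finrank F X') :
    (s.filter fun i => X ≤ S i).card = (s.filter fun i => X' ≤ S i).card := by
  suffices H : ∀ d ≤ t, ∀ X X' : Submodule F V, finrank F X = t - d → finrank F X' = t - d →
      (s.filter fun i => X ≤ S i).card = (s.filter fun i => X' ≤ S i).card from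
    H (t - finrank F X) (by omega) X X' (by omega) (by omega)
  intro d
  induction d with
  | zero => exact fun _ => h
  | succ d ih =>
    intro hd X X' hX hX'
    have hd' := ih (by omega)
    have hq := Finite.one_lt_card (α := F)
    -- Double count pairs `(i, y)` with `X ≤ S i` and `y ∈ S i \ X`; each `S i` has the same number
    -- of such `y`, and `X ⊔ ⟨y⟩` is one dimension larger.
    have count : ∀ X : Submodule F V, finrank F X = t - (d + 1) →
        (s.filter fun i => X ≤ S i).card * (Nat.card F ^ b - Nat.card F ^ (t - (d + 1))) =
          ∑ y : V with y ∉ X, (s.filter fun i => X ⊔ Submodule.span F {y} ≤ S i).card := by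
      intro X hX
      have h1 := Finset.sum_card_bipartiteAbove_eq_sum_card_bipartiteBelow
        (s := s.filter fun i => X ≤ S i) (t := Finset.univ.filter fun y : V => y ∉ X)
        (fun i y => y ∈ S i)
      simp only [Finset.bipartiteAbove, Finset.bipartiteBelow, Finset.filter_filter] at h1
      have h2 : ∀ i ∈ s.filter (fun i => X ≤ S i),
          (Finset.univ.filter fun y : V => y ∉ X ∧ y ∈ S i).card =
            Nat.card F ^ b - Nat.card F ^ (t - (d + 1)) := by
        intro i hi
        obtain ⟨his, hXi⟩ := Finset.mem_filter.1 hi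
        rw [← hb i his, ← hX, ← Module.natCard_eq_pow_finrank (K := F),
          ← Module.natCard_eq_pow_finrank (K := F), Nat.card_eq_fintype_card,
          Nat.card_eq_fintype_card, Fintype.card_subtype, Fintype.card_subtype,
          ← Finset.card_sdiff_of_subset]
        · congr 1
          ext y
          simp [and_comm]
        · intro y
          simpa using @hXi y
      rw [Finset.sum_congr rfl h2, Finset.sum_const, smul_eq_mul] at h1
      rw [h1]
      refine Finset.sum_congr rfl fun y _ => ?_
      congr 1
      refine Finset.filter_congr fun i _ => ?_
      rw [sup_le_iff, Submodule.span_singleton_le_iff_mem]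
    have hfr : ∀ X : Submodule F V, finrank F X = t - (d + 1) → ∀ y ∉ X,
        finrank F ↥(X ⊔ Submodule.span F {y}) = t - d := by
      intro X hX y hy
      have hy0 : y ≠ 0 := fun h0 => hy (h0 ▸ X.zero_mem)
      have h1 := Submodule.finrank_sup_add_finrank_inf_eq X (Submodule.span F {y})
      have h2 : X ⊓ Submodule.span F {y} = ⊥ :=
        ((Submodule.disjoint_span_singleton' hy0).2 hy).eq_bot
      rw [h2, finrank_bot, finrank_span_singleton hy0] at h1
      omega
    have hpos : 0 < Nat.card F ^ b - Nat.card F ^ (t - (d + 1)) :=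
      Nat.sub_pos_of_lt (Nat.pow_lt_pow_right hq (by omega))
    refine Nat.eq_of_mul_eq_mul_right hpos ?_
    rw [count X hX, count X' hX']
    obtain ⟨E, hE, -⟩ := exists_linearEquiv_map_eq (S := X) (S' := X') (Y := ⊤) (Y' := ⊤)
      le_top le_top (hX.trans hX'.symm) rfl
    refine Finset.sum_equiv E.toEquiv ?_ ?_
    · intro y
      simp [← hE]
    · intro y hy
      have hy : y ∉ X := by simpa using hy
      refine hd' _ _ (hfr X hX y hy) (hfr X' hX' _ ?_)
      simpa [← hE] using hy

open scoped Classical in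
/-- Intersection numbers of a design: if moreover the intersections with `Y` and `Y'` take at most
`t + 1` dimensions, then each dimension occurs equally often for `Y` and `Y'`. -/
theorem card_finrank_inf_eq_of_design {ι : Type*} {s : Finset ι} {S : ι → Submodule F V} {b t : ℕ}
    (hb : ∀ i ∈ s, finrank F (S i) = b) (htb : t ≤ b)
    (h : ∀ T T' : Submodule F V, finrank F T = t → finrank F T' = t →
      (s.filter fun i => T ≤ S i).card = (s.filter fun i => T' ≤ S i).card)
    {Y Y' : Submodule F V} (hY : finrank F Y = finrank F Y') (W : Finset ℕ) (hWt : W.card ≤ t + 1)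
    (hW : ∀ i ∈ s, finrank F ↥(S i ⊓ Y) ∈ W) (hW' : ∀ i ∈ s, finrank F ↥(S i ⊓ Y') ∈ W) (r : ℕ) :
    (s.filter fun i => finrank F ↥(S i ⊓ Y) = r).card =
      (s.filter fun i => finrank F ↥(S i ⊓ Y') = r).card := by
  refine card_finrank_inf_eq W hW hW' (fun j hj => ?_) r
  obtain ⟨E, -, hE⟩ := exists_linearEquiv_map_eq (S := Y) (S' := Y') (Y := Y) (Y' := Y')
    le_rfl le_rfl hY hY
  -- Only `j < #W ≤ t + 1` occurs, so the spans have dimension at most `t`.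
  exact sum_tuples_eq E hE j (φ := fun X => (s.filter fun i => X ≤ S i).card)
    (φ' := fun X => (s.filter fun i => X ≤ S i).card) fun X _ hXj =>
      card_le_eq_of_finrank_le hb htb h (by omega) (LinearEquiv.finrank_map_eq E X).symm

end Subspaces

end RankMetric

namespace RankMetric

open Module

/-! ### Minimal codewords and shortened dual codes. -/

section Words

variable {F K : Type*} [Field F] [Field K] [Algebra F K] {m n : ℕ}
  (Γ : Module.Basis (Fin m) F K)

theorem finrank_dualCode_support (c : Fin n → K) :
    finrank F (dualCode (support Γ c)) = n - rankWt Γ c := by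
  have := finrank_add_finrank_dualCode (support Γ c)
  rw [rankWt_eq_finrank]
  omega

theorem inf_extension_eq_bot {C : Submodule K (Fin n → K)} {d : ℕ}
    (hd : ∀ c ∈ C, c ≠ 0 → d ≤ rankWt Γ c) {X : Submodule F (Fin n → F)} (hX : finrank F X < d) :
    C ⊓ extension Γ X = ⊥ := by
  rw [eq_bot_iff]
  rintro c ⟨hc, hcX⟩
  by_contra h0
  have h1 := hd c hc h0
  rw [rankWt_eq_finrank] at h1
  have h2 := Submodule.finrank_mono ((mem_extension Γ).1 hcX)
  omega

/-- Codewords of minimum rank are minimal. -/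
theorem isMinimalWord_of_rankWt_eq {C : Submodule K (Fin n → K)} {d : ℕ}
    (hd : ∀ c ∈ C, c ≠ 0 → d ≤ rankWt Γ c) (hd0 : 0 < d) {c : Fin n → K} (hc : c ∈ C)
    (hcd : rankWt Γ c = d) : IsMinimalWord Γ C c := by
  refine ⟨hc, fun c' hc' hle => ?_⟩
  have hc0 : c ≠ 0 := by
    rintro rfl
    rw [rankWt_zero] at hcd
    omega
  obtain ⟨i, hi⟩ := Function.ne_iff.1 hc0
  have hi : c i ≠ 0 := hi
  -- This multiple makes the difference vanish at coordinate `i`, where `c` does not. Vanishing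
  -- there is visible on the support, which must shrink strictly, below the minimum rank.
  refine ⟨c' i / c i, ?_⟩
  have hmem : ∀ x : Fin n → K,
      support Γ x ≤ dualCode (Submodule.span F {Pi.single i 1}) ↔ x i = 0 := by
    intro x
    rw [support_le_dualCode_iff]
    constructor
    · intro h
      simpa [Pi.single_apply, ite_smul] using
        h (Pi.single i 1) (Submodule.mem_span_singleton_self _)
    · intro h w hw
      obtain ⟨a, rfl⟩ := Submodule.mem_span_singleton.1 hw
      simp [Pi.single_apply, h]
  by_contra hne
  have hx0 : c' - (c' i / c i) • c ≠ 0 := sub_ne_zero.2 hne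
  have hxC : c' - (c' i / c i) • c ∈ C := C.sub_mem hc' (C.smul_mem _ hc)
  have hxle : support Γ (c' - (c' i / c i) • c) ≤ support Γ c :=
    (extension Γ (support Γ c)).sub_mem hle
      ((extension Γ (support Γ c)).smul_mem _ ((mem_extension Γ).2 le_rfl))
  have hxi : (c' - (c' i / c i) • c) i = 0 := by simp [hi]
  have hlt : support Γ (c' - (c' i / c i) • c) < support Γ c := by
    refine lt_of_le_of_ne hxle fun h => hi ?_
    rw [← hmem, ← h, hmem]
    exact hxi
  have h1 := Submodule.finrank_lt_finrank_of_lt hlt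
  have h2 := hd _ hxC hx0
  rw [rankWt_eq_finrank] at h2 hcd
  omega

/-- Attainment of the supremum is not needed: `rankWt Γ c - 1` is strictly below it, so some
admissible `p` exceeds that and is at least `rankWt Γ c`. -/
theorem isMinimalWord_of_le_minimalBound {C : Submodule K (Fin n → K)} {i : ℕ}
    (hi : (i : ℕ∞) ≤ minimalBound Γ C) {c : Fin n → K} (hc : c ∈ C) (hc0 : c ≠ 0)
    (hci : rankWt Γ c ≤ i) : IsMinimalWord Γ C c := by
  have hpos : rankWt Γ c ≠ 0 := fun h => hc0 ((rankWt_eq_zero_iff Γ).1 h)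
  have hlt : ((rankWt Γ c - 1 : ℕ) : ℕ∞) < minimalBound Γ C :=
    lt_of_lt_of_le (by exact_mod_cast (by omega : rankWt Γ c - 1 < i)) hi
  obtain ⟨p, hp, hlt⟩ := lt_sSup_iff.1 hlt
  refine hp c hc ?_
  have := Order.add_one_le_of_lt hlt
  calc (rankWt Γ c : ℕ∞) = ((rankWt Γ c - 1 + 1 : ℕ) : ℕ∞) := by
        rw [Nat.sub_add_cancel (by omega)]
    _ ≤ p := by exact_mod_cast this

variable [Fintype F] [Fintype K]

open scoped Classical in
/-- The finite set of words of `C`. -/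
noncomputable def codewords (C : Submodule K (Fin n → K)) : Finset (Fin n → K) :=
  Finset.univ.filter (· ∈ C)

omit [Fintype F] [Algebra F K] [Field F] in
theorem mem_codewords {C : Submodule K (Fin n → K)} {c : Fin n → K} :
    c ∈ codewords C ↔ c ∈ C := by simp [codewords]

omit [Fintype F] in
open scoped Classical in
theorem card_codewords_support_le (C : Submodule K (Fin n → K)) (X : Submodule F (Fin n → F)) :
    ((codewords C).filter fun c => support Γ c ≤ X).card =
      Nat.card K ^ finrank K ↥(C ⊓ extension Γ X) := by
  rw [← Module.natCard_eq_pow_finrank, Nat.card_eq_fintype_card, Fintype.card_subtype,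
    codewords, Finset.filter_filter]
  congr 1
  ext c
  simp [mem_extension]

open scoped Classical in
/-- The weight distribution of the dual code shortened to the orthogonal space of `T` depends only
on the dimension of `T`, provided there are few weights. -/
theorem card_dualCode_support_le_eq {C : Submodule K (Fin n → K)} {d t : ℕ}
    (hd : ∀ c ∈ C, c ≠ 0 → d ≤ rankWt Γ c) (htd : t < d)
    (hwt : {w ∈ Set.Icc 1 (n - t) | ∃ c ∈ dualCode C, rankWt Γ c = w}.ncard ≤ d - t)
    {T T' : Submodule F (Fin n → F)} (hT : finrank F T = t) (hT' : finrank F T' = t) (w : ℕ) :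
    (((codewords (dualCode C)).filter fun c => support Γ c ≤ dualCode T).filter
        fun c => rankWt Γ c = w).card =
      (((codewords (dualCode C)).filter fun c => support Γ c ≤ dualCode T').filter
        fun c => rankWt Γ c = w).card := by
  rcases Nat.eq_zero_or_pos w with rfl | hw
  · congr 1
    simp only [Finset.filter_filter]
    refine Finset.filter_congr fun c _ => ?_
    rw [rankWt_eq_zero_iff]
    constructor <;> rintro ⟨-, rfl⟩ <;> exact ⟨by rw [support_zero]; exact bot_le, rfl⟩
  rcases lt_or_ge n w with hwn | hwn
  · rw [Finset.filter_false_of_mem, Finset.filter_false_of_mem] <;>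
    · intro c _ h
      have := rankWt_le Γ c
      omega
  set A : Set ℕ := {w ∈ Set.Icc 1 (n - t) | ∃ c ∈ dualCode C, rankWt Γ c = w} with hA
  have hAfin : A.Finite := (Set.finite_Icc 1 (n - t)).subset (Set.sep_subset _ _)
  set W : Finset ℕ := hAfin.toFinset.image (n - ·) with hWdef
  have hWcard : W.card ≤ d - t :=
    Finset.card_image_le.trans (by rwa [← Set.ncard_eq_toFinset_card A hAfin])
  let s : Submodule F (Fin n → F) → Finset (Fin n → K) := fun X =>
    (codewords (dualCode C)).filter fun c => c ≠ 0 ∧ support Γ c ≤ dualCode X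
  have hmemW : ∀ X : Submodule F (Fin n → F), finrank F X = t → ∀ c ∈ s X,
      finrank F ↥(dualCode (support Γ c) ⊓ (⊤ : Submodule F (Fin n → F))) ∈ W := by
    intro X hX c hc
    obtain ⟨hcC, hc0, hcX⟩ := Finset.mem_filter.1 hc
    rw [inf_top_eq, finrank_dualCode_support]
    refine Finset.mem_image_of_mem _ (hAfin.mem_toFinset.2 ⟨⟨?_, ?_⟩, c, mem_codewords.1 hcC, rfl⟩)
    · exact Nat.one_le_iff_ne_zero.2 fun h => hc0 ((rankWt_eq_zero_iff Γ).1 h)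
    · have h1 := Submodule.finrank_mono hcX
      have h2 := finrank_add_finrank_dualCode X
      rw [rankWt_eq_finrank]
      omega
  -- Below dimension `d` the `C` side of the duality identity vanishes, leaving an explicit count.
  -- The `+ 1` is the zero word, left out of `s X` so that its rank is not among the nodes.
  have hcount : ∀ X Y : Submodule F (Fin n → F), finrank F ↥(X ⊔ Y) < d →
      ((s X).filter fun c => Y ≤ dualCode (support Γ c)).card + 1 =
        Nat.card K ^ (finrank K (dualCode C) - finrank F ↥(X ⊔ Y)) := by
    intro X Y hXY
    have h1 := finrank_inf_extension_dualCode Γ (dualCode C) (X ⊔ Y)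
    rw [dualCode_dualCode, inf_extension_eq_bot Γ hd hXY, finrank_bot] at h1
    rw [show finrank K (dualCode C) - finrank F ↥(X ⊔ Y) =
      finrank K ↥(dualCode C ⊓ extension Γ (dualCode (X ⊔ Y))) by omega,
      ← card_codewords_support_le, ← Finset.card_erase_add_one
        (s := (codewords (dualCode C)).filter fun c => support Γ c ≤ dualCode (X ⊔ Y)) (a := 0)]
    · congr 2
      ext c
      simp only [s, Finset.mem_filter, Finset.mem_erase, dualCode_sup, le_inf_iff,
        le_dualCode_comm (C := Y)]
      tauto
    · simp [mem_codewords, support_zero]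
  obtain ⟨E, hE, hEtop⟩ := exists_linearEquiv_map_eq (S := T) (S' := T') (Y := ⊤) (Y' := ⊤)
    le_top le_top (hT.trans hT'.symm) rfl
  have key := card_finrank_inf_eq (s := s T) (s' := s T') (S := fun c => dualCode (support Γ c))
    (S' := fun c => dualCode (support Γ c)) (Y := ⊤) (Y' := ⊤) W (hmemW T hT) (hmemW T' hT')
    (fun j hj => sum_tuples_eq E hEtop j
      (φ := fun X => ((s T).filter fun c => X ≤ dualCode (support Γ c)).card)
      (φ' := fun X => ((s T').filter fun c => X ≤ dualCode (support Γ c)).card) (by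
        -- Here `j < #W ≤ d - t`, hence `dim (T ⊔ X) ≤ t + j < d`.
        intro X _ hXj
        have h1 := Submodule.finrank_add_le_finrank_add_finrank T X
        have h2 : finrank F ↥(T' ⊔ X.map E.toLinearMap) = finrank F ↥(T ⊔ X) := by
          rw [← hE, ← Submodule.map_sup, LinearEquiv.finrank_map_eq]
        have h3 := hcount T X (by omega)
        have h4 := hcount T' (X.map E.toLinearMap) (by omega)
        rw [h2] at h4
        exact Nat.succ_injective (h3.trans h4.symm))) (n - w)
  have hconv : ∀ X : Submodule F (Fin n → F),
      ((codewords (dualCode C)).filter fun c => support Γ c ≤ dualCode X).filter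
        (fun c => rankWt Γ c = w) = (s X).filter fun c =>
          finrank F ↥(dualCode (support Γ c) ⊓ (⊤ : Submodule F (Fin n → F))) = n - w := by
    intro X
    ext c
    have h1 := rankWt_le Γ c
    have h2 : rankWt Γ c = w → c ≠ 0 := fun h h0 => by
      rw [h0, rankWt_zero] at h
      omega
    simp only [s, Finset.mem_filter]
    have h3 : finrank F ↥(dualCode (support Γ c) ⊓ (⊤ : Submodule F (Fin n → F))) = n - w ↔
        rankWt Γ c = w := by
      rw [inf_top_eq, finrank_dualCode_support]
      omega
    rw [h3]
    tauto
  rw [hconv, hconv, key]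

open scoped Classical in
theorem card_dualCode_le_support_eq {C : Submodule K (Fin n → K)} {d t : ℕ}
    (hd : ∀ c ∈ C, c ≠ 0 → d ≤ rankWt Γ c) (htd : t < d)
    (hwt : {w ∈ Set.Icc 1 (n - t) | ∃ c ∈ dualCode C, rankWt Γ c = w}.ncard ≤ d - t)
    {w : ℕ} (hw : w + t ≤ n)
    {T T' : Submodule F (Fin n → F)} (hT : finrank F T = t) (hT' : finrank F T' = t) :
    ((codewords (dualCode C)).filter fun c => rankWt Γ c = w ∧ T ≤ support Γ c).card =
      ((codewords (dualCode C)).filter fun c => rankWt Γ c = w ∧ T' ≤ support Γ c).card := by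
  have hdim : ∀ c ∈ (codewords (dualCode C)).filter (fun c => rankWt Γ c = w),
      finrank F (dualCode (support Γ c)) = n - w := fun c hc => by
    rw [finrank_dualCode_support, (Finset.mem_filter.1 hc).2]
  have hperp : ∀ X : Submodule F (Fin n → F), finrank F X = t →
      finrank F (dualCode X) = n - t := fun X hX => by
    have := finrank_add_finrank_dualCode X
    omega
  have hrange : ∀ X : Submodule F (Fin n → F), finrank F X = t →
      ∀ c ∈ (codewords (dualCode C)).filter (fun c => rankWt Γ c = w),
      finrank F ↥(dualCode (support Γ c) ⊓ dualCode X) ∈ Finset.Icc (n - w - t) (n - w) := by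
    intro X hX c hc
    have h1 := Submodule.finrank_sup_add_finrank_inf_eq (dualCode (support Γ c)) (dualCode X)
    have h2 := (dualCode (support Γ c) ⊔ dualCode X).finrank_le
    rw [finrank_fin_fun] at h2
    rw [hdim c hc, hperp X hX] at h1
    have h3 := Submodule.finrank_mono
      (inf_le_left : dualCode (support Γ c) ⊓ dualCode X ≤ dualCode (support Γ c))
    rw [hdim c hc] at h3
    rw [Finset.mem_Icc]
    omega
  -- The complements of the supports form a `t`-design with multiplicity, and they meet `dualCode T`
  -- in at most `t + 1` dimensions. The top one, `n - w`, means `T ≤ support Γ c`.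
  have key := card_finrank_inf_eq_of_design (t := t) hdim (by omega) (by
      intro X X' hX hX'
      have := card_dualCode_support_le_eq Γ hd htd hwt hX hX' w
      simp only [Finset.filter_filter] at this ⊢
      simpa only [and_comm, le_dualCode_comm] using this)
    ((hperp T hT).trans (hperp T' hT').symm) (Finset.Icc (n - w - t) (n - w))
    (by rw [Nat.card_Icc]; omega) (hrange T hT) (hrange T' hT') (n - w)
  have hconv : ∀ X : Submodule F (Fin n → F),
      ((codewords (dualCode C)).filter fun c => rankWt Γ c = w ∧ X ≤ support Γ c) =
        ((codewords (dualCode C)).filter fun c => rankWt Γ c = w).filter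
          fun c => finrank F ↥(dualCode (support Γ c) ⊓ dualCode X) = n - w := by
    intro X
    rw [← Finset.filter_filter]
    refine Finset.filter_congr fun c hc => ?_
    rw [← dualCode_le_dualCode, ← inf_eq_left]
    constructor
    · intro h
      rw [h, hdim c hc]
    · intro h
      exact Submodule.eq_of_le_of_finrank_eq inf_le_left (by rw [h, hdim c hc])
  rw [hconv, hconv, key]

end Words

end RankMetric

namespace RankMetric

open Module

/-! ### From word counts to designs, and the Singleton case. -/

section Designs

variable {F K : Type*} [Field F] [Field K] [Algebra F K] {m n : ℕ}
  (Γ : Module.Basis (Fin m) F K)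

section Counts

variable [Fintype F] [Fintype K]

open scoped Classical in
/-- The weight distribution of `C` punctured along `T` depends only on the weight distribution of
the dual code shortened to the orthogonal space of `T`. -/
theorem card_finrank_dualCode_inf_eq {C : Submodule K (Fin n → K)}
    {T T' : Submodule F (Fin n → F)} (hTT' : finrank F T = finrank F T')
    (h : ∀ w, (((codewords (dualCode C)).filter fun c => support Γ c ≤ dualCode T).filter
        fun c => rankWt Γ c = w).card =
      (((codewords (dualCode C)).filter fun c => support Γ c ≤ dualCode T').filter
        fun c => rankWt Γ c = w).card) (r : ℕ) :
    ((codewords C).filter fun c =>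
        finrank F ↥(dualCode (support Γ c) ⊓ dualCode T) = r).card =
      ((codewords C).filter fun c =>
        finrank F ↥(dualCode (support Γ c) ⊓ dualCode T') = r).card := by
  have hle : ∀ X : Submodule F (Fin n → F), finrank F X ∈ Finset.range (n + 1) := fun X => by
    have := X.finrank_le
    rw [finrank_fin_fun] at this
    simpa [Nat.lt_succ_iff] using this
  -- All dimensions are allowed as nodes, since here every moment can be compared.
  refine card_finrank_inf_eq (Finset.range (n + 1)) (fun _ _ => hle _) (fun _ _ => hle _) ?_ r
  intro j _
  have hQ : (Nat.card K : ℚ) ≠ 0 := by exact_mod_cast Nat.card_pos.ne'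
  have hcount : ∀ X : Submodule F (Fin n → F),
      (((codewords C).filter fun c => X ≤ dualCode (support Γ c)).card : ℚ) =
        ∑ c ∈ codewords (dualCode C), if support Γ c ≤ X then
          (Nat.card K : ℚ) ^ finrank K C / (Nat.card K : ℚ) ^ finrank F X else 0 := by
    intro X
    rw [← Finset.sum_filter, Finset.sum_const, card_codewords_support_le, nsmul_eq_mul,
      mul_div_assoc', eq_div_iff (pow_ne_zero _ hQ)]
    simp only [le_dualCode_comm (C := X)]
    rw [card_codewords_support_le]
    push_cast
    rw [← pow_add, ← pow_add, finrank_inf_extension_dualCode, add_comm]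
  have hsum : ∀ Y : Submodule F (Fin n → F),
      ((∑ y : Fin j → Y, ((codewords C).filter fun c =>
        Submodule.span F (Set.range fun l => (y l : Fin n → F)) ≤
          dualCode (support Γ c)).card : ℕ) : ℚ) =
      ∑ c ∈ (codewords (dualCode C)).filter (fun c => support Γ c ≤ Y), ∑ y : Fin j → Y,
        if support Γ c ≤ Submodule.span F (Set.range fun l => (y l : Fin n → F)) then
          (Nat.card K : ℚ) ^ finrank K C / (Nat.card K : ℚ) ^
            finrank F (Submodule.span F (Set.range fun l => (y l : Fin n → F))) else 0 := by
    intro Y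
    push_cast
    simp only [hcount]
    rw [Finset.sum_comm, Finset.sum_filter]
    refine Finset.sum_congr rfl fun c _ => ?_
    split_ifs with hc
    · rfl
    · refine Finset.sum_eq_zero fun y _ => if_neg fun hle => hc (hle.trans ?_)
      rw [Submodule.span_le]
      rintro _ ⟨l, rfl⟩
      exact (y l).2
  have hYY' : finrank F (dualCode T) = finrank F (dualCode T') := by
    have h1 := finrank_add_finrank_dualCode T
    have h2 := finrank_add_finrank_dualCode T'
    omega
  -- The inner sum depends only on the rank of `c`: flags `support Γ c ≤ dualCode T` of equal
  -- dimensions are equivalent.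
  have main := sum_eq_sum_of_card_fiber_eq h (f := fun c => ∑ y : Fin j → dualCode T,
        if support Γ c ≤ Submodule.span F (Set.range fun l => (y l : Fin n → F)) then
          (Nat.card K : ℚ) ^ finrank K C / (Nat.card K : ℚ) ^
            finrank F (Submodule.span F (Set.range fun l => (y l : Fin n → F))) else 0)
      (f' := fun c => ∑ y : Fin j → dualCode T',
        if support Γ c ≤ Submodule.span F (Set.range fun l => (y l : Fin n → F)) then
          (Nat.card K : ℚ) ^ finrank K C / (Nat.card K : ℚ) ^
            finrank F (Submodule.span F (Set.range fun l => (y l : Fin n → F))) else 0) (by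
    intro c hc c' hc' hcc'
    rw [rankWt_eq_finrank, rankWt_eq_finrank] at hcc'
    obtain ⟨E, hE, hEY⟩ := exists_linearEquiv_map_eq (Finset.mem_filter.1 hc).2
      (Finset.mem_filter.1 hc').2 hcc' hYY'
    refine sum_tuples_eq E hEY j (φ := fun X => if support Γ c ≤ X then
        (Nat.card K : ℚ) ^ finrank K C / (Nat.card K : ℚ) ^ finrank F X else 0)
      (φ' := fun X => if support Γ c' ≤ X then
        (Nat.card K : ℚ) ^ finrank K C / (Nat.card K : ℚ) ^ finrank F X else 0) ?_
    intro X _ _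
    rw [LinearEquiv.finrank_map_eq, ← hE, Submodule.map_le_map_iff_of_injective E.injective])
  rw [← hsum, ← hsum] at main
  exact_mod_cast main

open scoped Classical in
/-- The codewords of rank `w`, taken with multiplicity, cover every `t`-dimensional subspace by
their supports equally often. -/
theorem card_le_support_eq {C : Submodule K (Fin n → K)} {d t : ℕ}
    (hd : ∀ c ∈ C, c ≠ 0 → d ≤ rankWt Γ c) (htd : t < d)
    (hwt : {w ∈ Set.Icc 1 (n - t) | ∃ c ∈ dualCode C, rankWt Γ c = w}.ncard ≤ d - t)
    (w : ℕ) {T T' : Submodule F (Fin n → F)} (hT : finrank F T = t) (hT' : finrank F T' = t) :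
    ((codewords C).filter fun c => rankWt Γ c = w ∧ T ≤ support Γ c).card =
      ((codewords C).filter fun c => rankWt Γ c = w ∧ T' ≤ support Γ c).card := by
  induction w using Nat.strong_induction_on generalizing T T' with
  | _ w ih =>
  rcases lt_or_ge n w with hwn | hwn
  · rw [Finset.filter_false_of_mem, Finset.filter_false_of_mem] <;>
    · intro c _ h
      have := rankWt_le Γ c
      omega
  have hdim : ∀ X : Submodule F (Fin n → F), finrank F X = t → ∀ c : Fin n → K,
      rankWt Γ c + t + finrank F ↥(dualCode (support Γ c) ⊓ dualCode X) =
        n + finrank F ↥(support Γ c ⊓ X) := by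
    intro X hX c
    rw [← dualCode_sup]
    have h1 := finrank_add_finrank_dualCode (support Γ c ⊔ X)
    have h2 := Submodule.finrank_sup_add_finrank_inf_eq (support Γ c) X
    rw [rankWt_eq_finrank]
    omega
  have hinf : ∀ (X : Submodule F (Fin n → F)) (c : Fin n → K),
      finrank F ↥(dualCode (support Γ c) ⊓ dualCode X) ≤ n - rankWt Γ c := by
    intro X c
    rw [← finrank_dualCode_support]
    exact Submodule.finrank_mono inf_le_left
  -- The dimension `n - w` says `dim (support Γ c + T) = w`. Rank `v > w` is impossible; for `v < w`
  -- the induction hypothesis supplies intersection numbers with `T`.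
  have hfiber : ∀ v ≠ w,
      (((codewords C).filter fun c =>
        finrank F ↥(dualCode (support Γ c) ⊓ dualCode T) = n - w).filter
          fun c => rankWt Γ c = v).card =
      (((codewords C).filter fun c =>
        finrank F ↥(dualCode (support Γ c) ⊓ dualCode T') = n - w).filter
          fun c => rankWt Γ c = v).card := by
    intro v hv
    simp only [Finset.filter_filter]
    rcases lt_or_gt_of_ne hv with hvw | hvw
    · rcases Nat.eq_zero_or_pos v with rfl | hv0
      · congr 1
        refine Finset.filter_congr fun c _ => and_congr_left fun hc => ?_
        have h1 := hdim T hT c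
        have h2 := hdim T' hT' c
        rw [(support_eq_bot_iff Γ).2 ((rankWt_eq_zero_iff Γ).1 hc), bot_inf_eq, finrank_bot] at h1 h2
        rw [(support_eq_bot_iff Γ).2 ((rankWt_eq_zero_iff Γ).1 hc)]
        omega
      -- Nonzero words have rank at least `d > t`, so the remaining `v` satisfy the requirement `t ≤
      -- v` on block dimensions.
      rcases lt_or_ge v d with hvd | hvd
      · rw [Finset.filter_false_of_mem, Finset.filter_false_of_mem] <;>
        · rintro c hc ⟨-, h⟩
          have := hd c (mem_codewords.1 hc) fun h0 => by
            rw [h0, rankWt_zero] at h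
            omega
          omega
      have hmem : ∀ X : Submodule F (Fin n → F), finrank F X = t →
          ∀ c ∈ (codewords C).filter (fun c => rankWt Γ c = v),
          finrank F ↥(support Γ c ⊓ X) ∈ Finset.range (t + 1) := by
        intro X hX c _
        have := Submodule.finrank_mono (inf_le_right : support Γ c ⊓ X ≤ X)
        rw [Finset.mem_range]
        omega
      have hvt := card_finrank_inf_eq_of_design (t := t)
        (s := (codewords C).filter fun c => rankWt Γ c = v) (S := support Γ) (b := v)
        (fun c hc => by rw [← rankWt_eq_finrank, (Finset.mem_filter.1 hc).2]) (by omega)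
        (fun X X' hX hX' => by simpa only [Finset.filter_filter] using ih v hvw hX hX')
        (hT.trans hT'.symm) (Finset.range (t + 1)) (by simp) (hmem T hT) (hmem T' hT')
        (v + t - w)
      -- If `v + t < w`, the subtraction in `v + t - w` truncates and both sets are empty.
      rcases lt_or_ge (v + t) w with hlt | hge
      · rw [Finset.filter_false_of_mem, Finset.filter_false_of_mem]
        · rintro c hc ⟨h1, h2⟩
          have := hdim T' hT' c
          omega
        · rintro c hc ⟨h1, h2⟩
          have := hdim T hT c
          omega
      simp only [Finset.filter_filter] at hvt
      convert hvt using 2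
      · refine Finset.filter_congr fun c _ => ?_
        have := hdim T hT c
        constructor <;> rintro ⟨h1, h2⟩ <;> constructor <;> omega
      · refine Finset.filter_congr fun c _ => ?_
        have := hdim T' hT' c
        constructor <;> rintro ⟨h1, h2⟩ <;> constructor <;> omega
    · rw [Finset.filter_false_of_mem, Finset.filter_false_of_mem]
      · rintro c hc ⟨h1, h2⟩
        have := hinf T' c
        have := rankWt_le Γ c
        omega
      · rintro c hc ⟨h1, h2⟩
        have := hinf T c
        have := rankWt_le Γ c
        omega
  have htotal := card_finrank_dualCode_inf_eq Γ (C := C) (hT.trans hT'.symm)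
    (fun v => card_dualCode_support_le_eq Γ hd htd hwt hT hT' v) (n - w)
  have hmaps : ∀ s : Finset (Fin n → K), ∀ c ∈ s, rankWt Γ c ∈ Finset.range (n + 1) :=
    fun s c _ => Finset.mem_range.2 (Nat.lt_succ_of_le (rankWt_le Γ c))
  rw [Finset.card_eq_sum_card_fiberwise (hmaps _), Finset.card_eq_sum_card_fiberwise (hmaps _),
    ← Finset.add_sum_erase _ _ (Finset.mem_range.2 (Nat.lt_succ_of_le hwn)),
    ← Finset.add_sum_erase _ _ (Finset.mem_range.2 (Nat.lt_succ_of_le hwn)),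
    Finset.sum_congr rfl fun v hv => hfiber v (Finset.ne_of_mem_erase hv)] at htotal
  have hw := Nat.add_right_cancel htotal
  have hconv : ∀ X : Submodule F (Fin n → F),
      ((codewords C).filter fun c => rankWt Γ c = w ∧ X ≤ support Γ c) =
        ((codewords C).filter fun c =>
          finrank F ↥(dualCode (support Γ c) ⊓ dualCode X) = n - w).filter
            fun c => rankWt Γ c = w := by
    intro X
    rw [Finset.filter_filter]
    refine Finset.filter_congr fun c _ => ?_
    rw [and_comm]
    refine and_congr_left fun hc => ?_
    rw [← hc, ← finrank_dualCode_support, ← dualCode_le_dualCode, ← inf_eq_left]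
    constructor
    · intro h
      rw [h]
    · intro h
      exact Submodule.eq_of_le_of_finrank_eq inf_le_left h
  rw [hconv, hconv, hw]

omit [Fintype F] in
open scoped Classical in
/-- A set of minimal codewords closed under nonzero multiples has `|K| - 1` words per support. -/
theorem card_eq_card_image_support_mul {C : Submodule K (Fin n → K)} {s : Finset (Fin n → K)}
    (hs : ∀ c ∈ s, c ≠ 0 ∧ IsMinimalWord Γ C c)
    (hs' : ∀ c ∈ s, ∀ c' ∈ C, support Γ c' = support Γ c → c' ∈ s) :
    s.card = (s.image (support Γ)).card * (Fintype.card K - 1) := by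
  rw [Finset.card_eq_sum_card_image (support Γ) s, ← smul_eq_mul]
  refine Finset.sum_const_nat fun U hU => ?_
  obtain ⟨c, hc, rfl⟩ := Finset.mem_image.1 hU
  obtain ⟨hc0, hcC, hmin⟩ := hs c hc
  have : (s.filter fun x => support Γ x = support Γ c) =
      (Finset.univ.erase (0 : K)).image (· • c) := by
    ext x
    simp only [Finset.mem_filter, Finset.mem_image, Finset.mem_erase, Finset.mem_univ, and_true]
    constructor
    · rintro ⟨hx, hxc⟩
      obtain ⟨ν, rfl⟩ := hmin x (hs x hx).2.1 hxc.le
      exact ⟨ν, fun h => (hs _ hx).1 (by rw [h, zero_smul]), rfl⟩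
    · rintro ⟨ν, hν, rfl⟩
      exact ⟨hs' c hc _ (C.smul_mem ν hcC) (support_smul Γ hν c), support_smul Γ hν c⟩
  rw [this, Finset.card_image_of_injective _ (smul_left_injective K hc0),
    Finset.card_erase_of_mem (Finset.mem_univ _), Finset.card_univ]

open scoped Classical in
-- Minimality makes each block the support of exactly `|K| - 1` words, so equal word counts give
-- equal block counts.
theorem isSubspaceDesign_supportsOfWeight {C : Submodule K (Fin n → K)} {t w : ℕ} (ht : 0 < t)
    (hw : 0 < w) (hmin : ∀ c ∈ C, rankWt Γ c = w → IsMinimalWord Γ C c)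
    (h : ∀ T T' : Submodule F (Fin n → F), finrank F T = t → finrank F T' = t →
      ((codewords C).filter fun c => rankWt Γ c = w ∧ T ≤ support Γ c).card =
        ((codewords C).filter fun c => rankWt Γ c = w ∧ T' ≤ support Γ c).card) :
    IsSubspaceDesign t w (supportsOfWeight Γ C w) := by
  refine ⟨ht, hw, ?_, ?_⟩
  · rintro _ ⟨c, -, hc, rfl⟩
    rw [← rankWt_eq_finrank, hc]
  by_cases hT₀ : ∃ T₀ : Submodule F (Fin n → F), finrank F T₀ = t
  swap
  · exact ⟨0, fun T hT => absurd ⟨T, hT⟩ hT₀⟩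
  obtain ⟨T₀, hT₀⟩ := hT₀
  have hset : ∀ T : Submodule F (Fin n → F), {U ∈ supportsOfWeight Γ C w | T ≤ U} =
      ↑(((codewords C).filter fun c => rankWt Γ c = w ∧ T ≤ support Γ c).image (support Γ)) := by
    intro T
    ext U
    simp only [supportsOfWeight, Set.mem_ofPred_eq, Finset.coe_image, Set.mem_image,
      Finset.mem_coe, Finset.mem_filter, mem_codewords]
    constructor
    · rintro ⟨⟨c, hc, hcw, rfl⟩, hT⟩
      exact ⟨c, ⟨hc, hcw, hT⟩, rfl⟩
    · rintro ⟨c, ⟨hc, hcw, hT⟩, rfl⟩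
      exact ⟨⟨c, hc, hcw, rfl⟩, hT⟩
  have hcard : ∀ T : Submodule F (Fin n → F),
      ((codewords C).filter fun c => rankWt Γ c = w ∧ T ≤ support Γ c).card =
        (((codewords C).filter fun c => rankWt Γ c = w ∧ T ≤ support Γ c).image
          (support Γ)).card * (Fintype.card K - 1) := by
    intro T
    refine card_eq_card_image_support_mul Γ (C := C) ?_ ?_
    · intro c hc
      simp only [Finset.mem_filter, mem_codewords] at hc
      refine ⟨?_, hmin c hc.1 hc.2.1⟩
      rintro rfl
      rw [rankWt_zero] at hc
      omega
    · intro c hc c' hc' hcc'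
      simp only [Finset.mem_filter, mem_codewords] at hc ⊢
      rw [rankWt_eq_finrank] at hc ⊢
      rw [hcc']
      exact ⟨hc', hc.2⟩
  refine ⟨(((codewords C).filter fun c => rankWt Γ c = w ∧ T₀ ≤ support Γ c).image
    (support Γ)).card, fun T hT => ?_⟩
  rw [hset T, Set.encard_coe_eq_coe_finsetCard, Nat.cast_inj]
  refine Nat.eq_of_mul_eq_mul_right (Nat.sub_pos_of_lt (Fintype.one_lt_card (α := K))) ?_
  rw [← hcard T, h T T₀ hT hT₀, hcard T₀]

end Counts

theorem minimalSupports_eq_supportsOfWeight {C : Submodule K (Fin n → K)} {w : ℕ}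
    (hmin : ∀ c ∈ C, rankWt Γ c = w → IsMinimalWord Γ C c) :
    minimalSupports Γ C w = supportsOfWeight Γ C w := by
  ext U
  constructor
  · rintro ⟨hU, c, hc, rfl⟩
    exact ⟨c, hc.1, by rw [rankWt_eq_finrank, hU], rfl⟩
  · rintro ⟨c, hc, hcw, rfl⟩
    exact ⟨by rw [← rankWt_eq_finrank, hcw], c, hmin c hc hcw, rfl⟩

/-- All subspaces of a given dimension form a design. -/
theorem isSubspaceDesign_finrank_eq {V : Type*} [AddCommGroup V] [Module F V] [Finite V]
    {t w : ℕ} (ht : 0 < t) (hw : 0 < w) :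
    IsSubspaceDesign t w {U : Submodule F V | finrank F U = w} := by
  refine ⟨ht, hw, fun U hU => hU, ?_⟩
  by_cases hT₀ : ∃ T₀ : Submodule F V, finrank F T₀ = t
  swap
  · exact ⟨0, fun T hT => absurd ⟨T, hT⟩ hT₀⟩
  obtain ⟨T₀, hT₀⟩ := hT₀
  refine ⟨{U ∈ {U : Submodule F V | finrank F U = w} | T₀ ≤ U}.ncard, fun T hT => ?_⟩
  rw [Set.Finite.cast_ncard_eq (Set.toFinite _)]
  obtain ⟨E, hE, -⟩ := exists_linearEquiv_map_eq (S := T) (S' := T₀) (Y := ⊤) (Y' := ⊤)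
    le_top le_top (hT.trans hT₀.symm) rfl
  rw [← (Submodule.map_injective_of_injective E.injective).encard_image]
  congr 1
  ext U
  constructor
  · rintro ⟨U, ⟨hU, hTU⟩, rfl⟩
    exact ⟨(LinearEquiv.finrank_map_eq E U).trans hU, hE ▸ Submodule.map_mono hTU⟩
  · rintro ⟨hU, hTU⟩
    refine ⟨U.map E.symm.toLinearMap, ⟨(LinearEquiv.finrank_map_eq E.symm U).trans hU, ?_⟩, ?_⟩
    · rw [← hE] at hTU
      intro x hx
      exact ⟨E x, hTU (Submodule.mem_map_of_mem hx), by simp⟩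
    · ext x
      simp

variable [Finite F]

/-- The Singleton bound for the minimum rank. -/
theorem finrank_add_le_of_le_rankWt {C : Submodule K (Fin n → K)} {d : ℕ}
    (hd : ∀ c ∈ C, c ≠ 0 → d ≤ rankWt Γ c) (hd0 : 0 < d) (hdn : d ≤ n) :
    finrank K C + d ≤ n + 1 := by
  -- A space of dimension `d - 1` supports no nonzero codeword, and the duality identity then bounds
  -- the dimension of `C`.
  obtain ⟨f, hf⟩ := exists_linearIndependent_of_le_finrank (R := F) (M := Fin n → F) (n := d - 1)
    (by rw [finrank_fin_fun]; omega)
  have hX := finrank_span_eq_card hf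
  rw [Fintype.card_fin] at hX
  set X := Submodule.span F (Set.range f)
  have h1 := finrank_inf_extension_dualCode Γ C (dualCode X)
  have h2 := finrank_add_finrank_dualCode X
  rw [dualCode_dualCode, inf_extension_eq_bot Γ hd (by omega), finrank_bot] at h1
  omega

/-- The supports of the words of minimum rank of a code attaining the Singleton bound. -/
theorem supportsOfWeight_eq_of_singleton {C : Submodule K (Fin n → K)} {d : ℕ}
    (hd : ∀ c ∈ C, c ≠ 0 → d ≤ rankWt Γ c) (h : n + 1 ≤ finrank K C + d) :
    supportsOfWeight Γ C d = {U : Submodule F (Fin n → F) | finrank F U = d} := by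
  ext U
  constructor
  · rintro ⟨c, -, hc, rfl⟩
    exact (rankWt_eq_finrank Γ c).symm.trans hc
  · intro hU
    have hU : finrank F U = d := hU
    have h1 := finrank_inf_extension_dualCode Γ C (dualCode U)
    have h2 := finrank_add_finrank_dualCode U
    rw [dualCode_dualCode] at h1
    have hne : C ⊓ extension Γ U ≠ ⊥ := fun h0 => by
      rw [h0, finrank_bot] at h1
      omega
    obtain ⟨c, ⟨hcC, hcU⟩, hc0⟩ := Submodule.exists_mem_ne_zero_of_ne_bot hne
    have h3 := hd c hcC hc0
    have hcU : support Γ c ≤ U := hcU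
    have h4 := Submodule.finrank_mono hcU
    rw [rankWt_eq_finrank] at h3
    exact ⟨c, hcC, by rw [rankWt_eq_finrank]; omega,
      Submodule.eq_of_le_of_finrank_eq hcU (by omega)⟩

end Designs

end RankMetric

open RankMetric in
theorem corollary5p12 {F K : Type*} [Field F] [Finite F] [Field K] [Algebra F K] {m n : ℕ}
    (Γ : Module.Basis (Fin m) F K) (C : Submodule K (Fin n → K)) (k d d' t : ℕ)
    (hC : RankMetric.IsCode Γ C k d) (ht : 0 < t) (htd : t < d)
    (hC' : RankMetric.IsCode Γ (RankMetric.dualCode C) (n - k) d')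
    (hwt : {w ∈ Set.Icc 1 (n - t) |
      ∃ c ∈ RankMetric.dualCode C, RankMetric.rankWt Γ c = w}.ncard ≤ d - t) :
    (RankMetric.IsSubspaceDesign t d (RankMetric.supportsOfWeight Γ C d) ∧
      RankMetric.IsSubspaceDesign t d'
        (RankMetric.supportsOfWeight Γ (RankMetric.dualCode C) d')) ∧
    (∀ i : ℕ, d ≤ i → (i : ℕ∞) ≤ RankMetric.minimalBound Γ C →
      RankMetric.IsSubspaceDesign t (min i (n - t))
        (RankMetric.minimalSupports Γ C (min i (n - t)))) ∧
    (∀ i : ℕ, d' ≤ i → (i : ℕ∞) ≤ RankMetric.minimalBound Γ (RankMetric.dualCode C) →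
      RankMetric.IsSubspaceDesign t (min i (n - t))
        (RankMetric.minimalSupports Γ (RankMetric.dualCode C) (min i (n - t)))) := by
  classical
  have := Module.Finite.of_basis Γ
  have : Finite K := Module.finite_of_finite F
  have := Fintype.ofFinite F
  have := Fintype.ofFinite K
  have hbasic : ∀ (D : Submodule K (Fin n → K)) (k e : ℕ), IsCode Γ D k e →
      (∀ c ∈ D, c ≠ 0 → e ≤ rankWt Γ c) ∧ 0 < e ∧ e ≤ n := by
    rintro D k e ⟨-, ⟨c, -, hc0, rfl⟩, hlb⟩
    exact ⟨fun c' hc' h0 => hlb ⟨c', hc', h0, rfl⟩,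
      Nat.pos_of_ne_zero fun h => hc0 ((rankWt_eq_zero_iff Γ).1 h), rankWt_le Γ c⟩
  obtain ⟨hd, hd0, hdn⟩ := hbasic C k d hC
  obtain ⟨hd', hd0', hdn'⟩ := hbasic _ _ d' hC'
  have hbound : ∀ (D : Submodule K (Fin n → K)) (i w : ℕ), 0 < w → w ≤ i →
      (i : ℕ∞) ≤ minimalBound Γ D → ∀ c ∈ D, rankWt Γ c = w → IsMinimalWord Γ D c := by
    intro D i w hw0 hwi hi c hc hcw
    refine isMinimalWord_of_le_minimalBound Γ hi hc ?_ (by omega)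
    rintro rfl
    rw [rankWt_zero] at hcw
    omega
  refine ⟨⟨?_, ?_⟩, ?_, ?_⟩
  · exact isSubspaceDesign_supportsOfWeight Γ ht hd0
      (fun c hc hcd => isMinimalWord_of_rankWt_eq Γ hd hd0 hc hcd)
      (fun T T' hT hT' => card_le_support_eq Γ hd htd hwt d hT hT')
  · rcases le_or_gt (d' + t) n with hle | hgt
    · exact isSubspaceDesign_supportsOfWeight Γ ht hd0'
        (fun c hc hcd => isMinimalWord_of_rankWt_eq Γ hd' hd0' hc hcd)
        (fun T T' hT hT' => card_dualCode_le_support_eq Γ hd htd hwt hle hT hT')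
    · have h1 := finrank_add_le_of_le_rankWt Γ hd hd0 hdn
      have h2 := finrank_add_finrank_dualCode C
      rw [supportsOfWeight_eq_of_singleton Γ hd' (by omega)]
      exact isSubspaceDesign_finrank_eq ht hd0'
  · intro i hdi hi
    -- Positivity comes from `t < d ≤ n` and `0 < d ≤ i`.
    have hw0 : 0 < min i (n - t) := by omega
    have hmin := hbound C i _ hw0 (min_le_left _ _) hi
    rw [minimalSupports_eq_supportsOfWeight Γ hmin]
    exact isSubspaceDesign_supportsOfWeight Γ ht hw0 hmin
      (fun T T' hT hT' => card_le_support_eq Γ hd htd hwt _ hT hT')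
  · intro i hdi hi
    have hw0 : 0 < min i (n - t) := by omega
    have hmin := hbound (dualCode C) i _ hw0 (min_le_left _ _) hi
    rw [minimalSupports_eq_supportsOfWeight Γ hmin]
    exact isSubspaceDesign_supportsOfWeight Γ ht hw0 hmin
      (fun T T' hT hT' => card_dualCode_le_support_eq Γ hd htd hwt (by omega) hT hT')
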